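/- Let $I$ be a finite set of unit-demand agents and $J$ a finite set of services. Agent $i$ has a value $v_{ij}\ge 0$ for service $j$, and the values $v_{ij}$, $(i,j)\in I\times J$, are independent random variables, $v_{ij}\sim F_{ij}$. A set of pairs $S\subseteq I\times J$ is a feasible allocation if $S\in\mathcal J=\mathcal J_1\cap\mathcal J_2$, where $\mathcal J_1$ is the family of independent sets of a matroid on $I\times J$ and $\mathcal J_2$ is the unit-demand constraint: for each $i\in I$ at most one pair $(i,j)$ is in $S$. Call this instance $\mathcal I$. A lottery is a vector $(q_1,\dots,q_m,p)$, $m=|J|$, of probabilities $q_j\ge0$ with $\sum_j q_j\le1$ and a price $p\in\mathbb R$; its utility to a buyer with values $t_1,\dots,t_m$ is $\sum_j q_jt_j-p$. A lottery-based mechanism $M^{\mathcal L}$ for $\mathcal I$ offers to each agent $i$, at each valuation vector $v$, a collection $\mathcal L_i(v)$ of lotteries that depends only on the values $v_{-i}$ of the other agents; agent $i$ picks a lottery $\ell_i(v)=(q_{i1}(v),\dots,q_{im}(v),p_i(v))$ of $\mathcal L_i(v)$, or no lottery (all probabilities and the price are then $0$), so as to maximize her utility; and it is required that $$\sum_{(i,j)\in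 S}q_{ij}(v)\le r(S)\qquad\text{for all } S\subseteq I\times J\text{ and all } v,$$ where $r(S)$ is the maximum cardinality of a feasible subset of $S$. Its expected revenue is $\mathcal R^{M^{\mathcal L}}=\mathbf E_v\big[\sum_{i\in I}p_i(v)\big]$. The single-parameter instance with copies $\mathcal I^{\text{copies}}$ has one pseudo-agent for each $(i,j)\in I\times J$, with value $v_{ij}\sim F_{ij}$ (independently) for being served, and the seller may serve any set of pseudo-agents in $\mathcal J$. A deterministic mechanism maps each bid vector to a set in $\mathcal J$ of served pseudo-agents and to a payment for each pseudo-agent; it is truthful if bidding her true value is optimal for each pseudo-agent whatever the others bid, and yields nonnegative utility. Let $\mathcal R^{\mathrm{Mye}}$ be the expected revenue of Myerson's (revenue-maximizing) mechanism for $\mathcal I^{\text{copies}}$, that is, the supremum of the expected revenue over all truthful deterministic mechanisms for $\mathcal I^{\text{copies}}$. Then for every lottery-based mechanism $M^{\mathcal L}$ for $\mathcal I$, $$\mathcal R^{M^{\mathcal L}}\le 5\,\mathcal R^{\mathrm{Mye}}.$$ -/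

import Mathlib

open MeasureTheory
open scoped NNReal ENNReal

noncomputable section

/-- The expectation `E[f] = E[f⁺] - E[f⁻]` of a real random variable, as an extended real number.
It is the usual expectation whenever `E[f⁺]` and `E[f⁻]` are not both infinite. -/
def extExpectation {Ω : Type*} [MeasurableSpace Ω] (μ : Measure Ω) (f : Ω → ℝ) : EReal :=
  ((∫⁻ ω, ENNReal.ofReal (f ω) ∂μ : ℝ≥0∞) : EReal) -
    ((∫⁻ ω, ENNReal.ofReal (-(f ω)) ∂μ : ℝ≥0∞) : EReal)

/-! ### Single-parameter mechanism design -/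

/-- An instance of the Bayesian single-parameter mechanism design problem with set of agents `E`:
the joint law of the agents' (nonnegative) values for being served, and the collection of the
sets of agents that may be served simultaneously. -/
structure BSMD (E : Type*) where
  law : Measure (E → ℝ≥0)
  feasible : Set (Finset E)

/-- A (deterministic) mechanism for a single-parameter instance: it maps every vector of bids to a
feasible set of served agents and to a payment for each agent. -/
structure BSMD.Mechanism {E : Type*} (P : BSMD E) where
  alloc : (E → ℝ≥0) → Finset E
  payment : E → (E → ℝ≥0) → ℝ
  alloc_feasible : ∀ b, alloc b ∈ P.feasible
  measurable_alloc : ∀ e, MeasurableSet {b | e ∈ alloc b}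
  measurable_payment : ∀ e, Measurable (payment e)

namespace BSMD.Mechanism

variable {E : Type*} {P : BSMD E}

open Classical in
/-- The utility of agent `e` with true value `t` when the bids are `b`. -/
def utility (A : P.Mechanism) (e : E) (t : ℝ≥0) (b : E → ℝ≥0) : ℝ :=
  (if e ∈ A.alloc b then (t : ℝ) else 0) - A.payment e b

/-- Truthfulness: whatever the others bid, bidding the true value is optimal for every agent
(incentive compatibility), and gives a nonnegative utility (voluntary participation). -/
structure IsTruthful (A : P.Mechanism) : Prop where
  incentive_compatible : ∀ (e : E) (v b : E → ℝ≥0), (∀ e', e' ≠ e → b e' = v e') →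
    A.utility e (v e) b ≤ A.utility e (v e) v
  individually_rational : ∀ (e : E) (v : E → ℝ≥0), 0 ≤ A.utility e (v e) v

/-- The expected revenue (with truthful bids). -/
def expectedRevenue [Fintype E] (A : P.Mechanism) : EReal :=
  extExpectation P.law fun v => ∑ e, A.payment e v

end BSMD.Mechanism

/-- The expected revenue of Myerson's mechanism, that is, the optimal expected revenue of a
truthful deterministic mechanism. -/
def BSMD.myersonRevenue {E : Type*} [Fintype E] (P : BSMD E) : EReal :=
  ⨆ (A : P.Mechanism) (_ : A.IsTruthful), A.expectedRevenue

/-! ### Multi-parameter unit-demand mechanism design -/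

/-- An instance of the Bayesian multi-parameter unit-demand mechanism design problem with set of
agents `I` and set of services `J`: the joint law of the (nonnegative) values `v (i, j)` of agent
`i` for service `j`, and the collection of the feasible allocations of services to agents. -/
structure BMUMD (I J : Type*) where
  law : Measure (I × J → ℝ≥0)
  feasible : Set (Finset (I × J))

/-- An allocation respects the unit-demand constraint if every agent gets at most one service. -/
def UnitDemand {I J : Type*} (S : Finset (I × J)) : Prop :=
  ∀ i j k, (i, j) ∈ S → (i, k) ∈ S → j = k

/-- Independent values, and a feasibility constraint that is the intersection of a matroid with
the unit-demand constraint. -/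
def BMUMD.IsMatroidUnitDemand {I J : Type*} [Fintype I] [Fintype J] (P : BMUMD I J) : Prop :=
  (∃ F : I × J → Measure ℝ≥0, (∀ e, IsProbabilityMeasure (F e)) ∧ P.law = Measure.pi F) ∧
  (∃ M : Matroid (I × J),
    P.feasible = {S : Finset (I × J) | M.Indep (S : Set (I × J)) ∧ UnitDemand S})

/-- The single-parameter instance with copies: every pair `(i, j)` becomes a pseudo-agent that is
interested in service `j` only. -/
def BMUMD.copies {I J : Type*} (P : BMUMD I J) : BSMD (I × J) where
  law := P.law
  feasible := P.feasible

open Classical in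
/-- The cardinality of a maximum-size feasible subset of `S`. -/
def BMUMD.rank {I J : Type*} (P : BMUMD I J) (S : Finset (I × J)) : ℕ :=
  (S.powerset.filter (· ∈ P.feasible)).sup Finset.card

/-! ### Lotteries -/

/-- A lottery over the services `J`: a (sub)probability vector together with a price. -/
structure Lottery (J : Type*) [Fintype J] where
  prob : J → ℝ
  price : ℝ
  prob_nonneg : ∀ j, 0 ≤ prob j
  sum_prob_le_one : ∑ j, prob j ≤ 1

namespace Lottery

variable {J : Type*} [Fintype J]

/-- Buying no lottery. -/
def none : Lottery J where
  prob := 0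
  price := 0
  prob_nonneg := by simp
  sum_prob_le_one := by simp

/-- The expected utility of a risk-neutral unit-demand buyer with values `t`. -/
def utility (l : Lottery J) (t : J → ℝ≥0) : ℝ :=
  ∑ j, l.prob j * (t j : ℝ) - l.price

end Lottery

/-- A lottery-based mechanism: for every valuation vector `v` it offers agent `i` the collection
`menu i v` of lotteries, which does not depend on agent `i`'s own values, and agent `i` picks
`choice i v`, a lottery of the collection or no lottery, so as to maximize her utility (ties are
broken arbitrarily). -/
structure BMUMD.LotteryMechanism {I J : Type*} [Fintype I] [Fintype J] (P : BMUMD I J) where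
  menu : I → (I × J → ℝ≥0) → Set (Lottery J)
  menu_congr : ∀ (i : I) (v w : I × J → ℝ≥0),
    (∀ k, k ≠ i → ∀ j, v (k, j) = w (k, j)) → menu i v = menu i w
  choice : I → (I × J → ℝ≥0) → Lottery J
  choice_mem : ∀ i v, choice i v ∈ menu i v ∨ choice i v = Lottery.none
  choice_optimal : ∀ i v, ∀ l ∈ menu i v,
    l.utility (fun j => v (i, j)) ≤ (choice i v).utility (fun j => v (i, j))
  choice_nonneg : ∀ i v, 0 ≤ (choice i v).utility (fun j => v (i, j))
  feasible : ∀ (v : I × J → ℝ≥0) (S : Finset (I × J)),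
    ∑ e ∈ S, (choice e.1 v).prob e.2 ≤ (P.rank S : ℝ)
  measurable_prob : ∀ i j, Measurable fun v => (choice i v).prob j
  measurable_price : ∀ i, Measurable fun v => (choice i v).price

/-- The expected revenue of a lottery-based mechanism. -/
def BMUMD.LotteryMechanism.expectedRevenue {I J : Type*} [Fintype I] [Fintype J]
    {P : BMUMD I J} (L : P.LotteryMechanism) : EReal :=
  extExpectation P.law fun v => ∑ i, (L.choice i v).price

end

/-! ### Greedy sets -/

section Greedy

variable {E : Type*}

/-! The bound holds pointwise in `v`, with constant 4 = 1 + 1 + 2. The prices sum to `∑ q_e v_e - ∑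
u_i`, where `u_i` is the utility of agent `i`. Let `G` be the greedy independent set with at most
two pairs per agent, and call an agent's best pair in `G` her favorite. Serving favorites is
feasible and monotone, so charging critical values is truthful for the copies. Keeping a second pair
in `G` forces the agent to pay at least its value: bidding less on the favorite would make the
second pair the favorite.

Favorites (cost 1): serve a favorite only if `q_e > θ`, with `θ` uniform in (0, 1). As `q_e` is a
subgradient of `u_i` in `v_e`, the average critical payment is at least `q_e v_e - u_i`
(`ofReal_mul_le_lintegral_criticalPayment`). Each agent has at most one favorite, so each `u_i` is
used at most once.

Other pairs (`sum_notMem_favorites_le`): a pair `f` dominated by two pairs of its own agent in `G`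
is worth at most that agent's payment; lottery probabilities sum to at most 1, so the cost is 1. Any
other `f` in the ground set is blocked by the matroid, and every other element of its fundamental
circuit is pivotal, so its agent pays at least `v f`. Thus the undominated pairs worth at least `t`
have rank at most the number of pairs of `G` whose agents pay at least `t`. Integrating over `t`
costs 2, as `G` has at most two pairs per agent. -/

open Classical in
/-- `S` is the outcome of the greedy algorithm for the feasible sets `𝓕`, where the elements are
considered in the order `r`. -/
def IsGreedy (𝓕 : Set (Finset E)) (r : E → E → Prop) (S : Finset E) : Prop :=
  ∀ e, e ∈ S ↔ insert e (S.filter fun x => r x e) ∈ 𝓕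

lemma IsGreedy.unique {𝓕 : Set (Finset E)} {r : E → E → Prop} (hr : WellFounded r)
    {S S' : Finset E} (h : IsGreedy 𝓕 r S) (h' : IsGreedy 𝓕 r S') : S = S' := by
  classical
  ext e
  induction e using hr.induction with
  | _ e ih =>
    rw [h e, h' e]
    have : (S.filter fun x => r x e) = S'.filter fun x => r x e := by
      ext x
      simp only [Finset.mem_filter]
      exact and_congr_left fun hx => ih x hx
    rw [this]

variable [Fintype E]

/-- The priority of an element in the greedy order: by decreasing value, ties broken by an
enumeration of `E`. -/
noncomputable def priority (v : E → ℝ≥0) (e : E) : ℝ≥0ᵒᵈ ×ₗ Fin (Fintype.card E) :=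
  toLex (OrderDual.toDual (v e), Fintype.equivFin E e)

/-- `x` is considered before `e` by the greedy algorithm. -/
def Precedes (v : E → ℝ≥0) (x e : E) : Prop := priority v x < priority v e

lemma priority_injective (v : E → ℝ≥0) : Function.Injective (priority v) := by
  intro a b h
  have := congrArg (fun p => (ofLex p).2) h
  simpa [priority] using this

lemma precedes_iff {v : E → ℝ≥0} {x e : E} :
    Precedes v x e ↔
      v e < v x ∨ v x = v e ∧ Fintype.equivFin E x < Fintype.equivFin E e := by
  simp [Precedes, priority, Prod.Lex.toLex_lt_toLex]

lemma Precedes.le {v : E → ℝ≥0} {x e : E} (h : Precedes v x e) : v e ≤ v x := by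
  rcases precedes_iff.1 h with h | h
  · exact h.le
  · exact h.1.ge

lemma precedes_of_lt {v : E → ℝ≥0} {x e : E} (h : v e < v x) : Precedes v x e :=
  precedes_iff.2 (Or.inl h)

lemma Precedes.ne {v : E → ℝ≥0} {x e : E} (h : Precedes v x e) : x ≠ e := by
  rintro rfl
  exact lt_irrefl _ h

lemma precedes_or {v : E → ℝ≥0} {x e : E} (h : x ≠ e) : Precedes v x e ∨ Precedes v e x :=
  lt_or_gt_of_ne fun h' => h (priority_injective v h')

lemma wellFounded_precedes (v : E → ℝ≥0) : WellFounded (Precedes v) := by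
  have : IsTrans E (Precedes v) := ⟨fun _ _ _ h h' => lt_trans h h'⟩
  have : Std.Irrefl (Precedes v) := ⟨fun _ h => lt_irrefl _ h⟩
  exact Finite.wellFounded_of_trans_of_irrefl _

open Classical in
lemma exists_isGreedy (𝓕 : Set (Finset E)) {r : E → E → Prop} (hr : WellFounded r) :
    ∃ S, IsGreedy 𝓕 r S := by
  let F : ∀ e, (∀ x, r x e → Prop) → Prop := fun e ih =>
    insert e (Finset.univ.filter fun x => ∃ h : r x e, ih x h) ∈ 𝓕
  refine ⟨Finset.univ.filter fun e => hr.fix F e, fun e => ?_⟩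
  rw [Finset.mem_filter, hr.fix_eq]
  simp only [Finset.mem_univ, true_and, F]
  have : (Finset.univ.filter fun x => ∃ _ : r x e, hr.fix F x) =
      (Finset.univ.filter fun x => hr.fix F x).filter fun x => r x e := by
    ext x
    simp [and_comm]
  rw [← this]

/-- The outcome of the greedy algorithm. -/
noncomputable def greedyOf (𝓕 : Set (Finset E)) (r : E → E → Prop) : Finset E :=
  Classical.epsilon (IsGreedy 𝓕 r)

/-- The outcome of the greedy algorithm for the values `v`. -/
noncomputable def greedy (𝓕 : Set (Finset E)) (v : E → ℝ≥0) : Finset E :=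
  greedyOf 𝓕 (Precedes v)

lemma isGreedy_greedy (𝓕 : Set (Finset E)) (v : E → ℝ≥0) :
    IsGreedy 𝓕 (Precedes v) (greedy 𝓕 v) :=
  Classical.epsilon_spec (exists_isGreedy 𝓕 (wellFounded_precedes v))

open Classical in
lemma mem_greedy_iff [DecidableEq E] {𝓕 : Set (Finset E)} {v : E → ℝ≥0} {e : E} :
    e ∈ greedy 𝓕 v ↔ insert e ((greedy 𝓕 v).filter fun x => Precedes v x e) ∈ 𝓕 := by
  convert isGreedy_greedy 𝓕 v e

lemma greedy_mem {𝓕 : Set (Finset E)} (h0 : ∅ ∈ 𝓕) (v : E → ℝ≥0) : greedy 𝓕 v ∈ 𝓕 := by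
  classical
  rcases (greedy 𝓕 v).eq_empty_or_nonempty with h | h
  · rwa [h]
  obtain ⟨e, he, hmax⟩ := Finset.exists_max_image _ (priority v) h
  have h1 := (isGreedy_greedy 𝓕 v e).1 he
  convert h1 using 1
  ext x
  simp only [Finset.mem_insert, Finset.mem_filter]
  refine ⟨fun hx => ?_, ?_⟩
  · by_cases hxe : x = e
    · exact Or.inl hxe
    · exact Or.inr ⟨hx, lt_of_le_of_ne (hmax x hx) fun h' => hxe (priority_injective v h')⟩
  · rintro (rfl | hx)
    exacts [he, hx.1]

/-- The relative order of other elements does not depend on the value of `e`. -/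
lemma precedes_update [DecidableEq E] {v : E → ℝ≥0} {e x y : E} (z : ℝ≥0) (hx : x ≠ e) (hy : y ≠ e) :
    Precedes (Function.update v e z) x y ↔ Precedes v x y := by
  simp [precedes_iff, hx, hy]

lemma Precedes.update [DecidableEq E] {v : E → ℝ≥0} {e x f : E} (hx : Precedes v x f) {z : ℝ≥0} (hz : v e ≤ z)
    (hf : f ≠ e) : Precedes (Function.update v e z) x f := by
  by_cases hxe : x = e
  · subst hxe
    rw [precedes_iff, Function.update_self, Function.update_of_ne hf]
    rcases precedes_iff.1 hx with h | h
    · exact Or.inl (h.trans_le hz)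
    · rcases hz.lt_or_eq with h' | h'
      · exact Or.inl (h.1 ▸ h')
      · exact Or.inr ⟨h' ▸ h.1, h.2⟩
  · exact (precedes_update z hxe hf).2 hx

/-- Raising the value of an element of the greedy set does not change the greedy set. -/
lemma greedy_update_eq [DecidableEq E] {𝓕 : Set (Finset E)} (h0 : ∅ ∈ 𝓕)
    (hmono : ∀ S S' : Finset E, S ⊆ S' → S' ∈ 𝓕 → S ∈ 𝓕) {v : E → ℝ≥0} {e : E}
    (he : e ∈ greedy 𝓕 v) {z : ℝ≥0} (hz : v e ≤ z) :
    greedy 𝓕 (Function.update v e z) = greedy 𝓕 v := by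
  rename_i inst
  obtain rfl : inst = fun a b => Classical.propDecidable (a = b) := Subsingleton.elim _ _
  classical
  set w := Function.update v e z with hw
  have hG := isGreedy_greedy 𝓕 v
  set G := greedy 𝓕 v with hGdef
  have hGF : G ∈ 𝓕 := greedy_mem h0 v
  refine IsGreedy.unique (wellFounded_precedes w) (isGreedy_greedy 𝓕 w) fun f => ?_
  constructor
  · intro hf
    refine hmono _ _ ?_ hGF
    intro x hx
    rcases Finset.mem_insert.1 hx with rfl | hx
    exacts [hf, (Finset.mem_filter.1 hx).1]
  · intro hf
    by_cases hfe : f = e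
    · rwa [hfe]
    -- Raising `e` can only add predecessors to `f`, so feasibility in the new order gives
    -- feasibility in the old one.
    refine (hG f).2 (hmono _ _ ?_ hf)
    refine Finset.insert_subset_insert _ fun x hx => ?_
    rw [Finset.mem_filter] at hx ⊢
    exact ⟨hx.1, hx.2.update hz hfe⟩

open Classical in
/-- If removing `e` from the greedy set unblocks `f`, then `e` is not in the greedy set any more
when her value drops below that of `f`. -/
lemma notMem_greedy_update [DecidableEq E] {𝓕 : Set (Finset E)} (h0 : ∅ ∈ 𝓕)
    (hmono : ∀ S S' : Finset E, S ⊆ S' → S' ∈ 𝓕 → S ∈ 𝓕) {v : E → ℝ≥0} {e f : E}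
    (hf : f ∉ greedy 𝓕 v) (hef : Precedes v e f)
    (hpiv : insert f (((greedy 𝓕 v).filter fun x => Precedes v x f).erase e) ∈ 𝓕)
    {z : ℝ≥0} (hz : z < v f) : e ∉ greedy 𝓕 (Function.update v e z) := by
  intro he
  have hzv : Function.update v e z e ≤ v e := by
    simpa using hz.le.trans hef.le
  -- If `e` survived the drop, raising it back would show that the greedy set never changed; but `e`
  -- no longer precedes `f`, so nothing blocks `f`.
  have hG := greedy_update_eq h0 hmono he hzv
  simp only [Function.update_idem, Function.update_eq_self] at hG
  rw [hG] at hf hpiv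
  have hfe : f ≠ e := hef.ne.symm
  refine hf (mem_greedy_iff.2 (hmono _ _ ?_ hpiv))
  refine Finset.insert_subset_insert _ fun x hx => ?_
  rw [Finset.mem_filter] at hx
  have hxe : x ≠ e := by
    rintro rfl
    have := hx.2.le
    simp only [ne_eq, hfe, not_false_eq_true, Function.update_of_ne, Function.update_self] at this
    exact absurd this (not_le.2 hz)
  rw [Finset.mem_erase, Finset.mem_filter]
  exact ⟨hxe, hx.1, (precedes_update z hxe hfe).1 hx.2⟩

lemma measurable_precedes : Measurable (Precedes : (E → ℝ≥0) → E → E → Prop) := by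
  refine measurable_pi_lambda _ fun a => measurable_pi_lambda _ fun b => ?_
  refine measurableSet_setOfPred.1 ?_
  simp only [precedes_iff]
  refine (measurableSet_lt (measurable_pi_apply b) (measurable_pi_apply a)).union ?_
  exact (measurableSet_eq_fun (measurable_pi_apply a) (measurable_pi_apply b)).inter
    (MeasurableSet.const _)

/-- A property that depends on the values only through the greedy order is measurable. -/
lemma measurableSet_precedes (s : Set (E → E → Prop)) :
    MeasurableSet {v : E → ℝ≥0 | Precedes v ∈ s} :=
  measurable_precedes (Set.toFinite s).measurableSet

end Greedy

/-! ### Truthful mechanisms from monotone allocation rules -/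

section CriticalPayment

variable {E : Type*}

/-- An allocation rule is monotone if raising the bid of a served agent keeps her served. -/
def MonotoneAlloc (x : (E → ℝ≥0) → Finset E) : Prop :=
  ∀ (_ : DecidableEq E) (e : E) (v : E → ℝ≥0) (z : ℝ≥0), e ∈ x v → v e ≤ z → e ∈ x (Function.update v e z)

open Classical in
/-- The length of the interval of bids with which agent `e` is not served. -/
noncomputable def criticalValue (x : (E → ℝ≥0) → Finset E) (e : E) (v : E → ℝ≥0) : ℝ≥0∞ :=
  volume {z : ℝ | 0 < z ∧ e ∉ x (Function.update v e z.toNNReal)}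

open Classical in
/-- Served agents pay their critical value. -/
noncomputable def criticalPayment (x : (E → ℝ≥0) → Finset E) (e : E) (v : E → ℝ≥0) : ℝ≥0∞ :=
  if e ∈ x v then criticalValue x e v else 0

lemma criticalValue_le {x : (E → ℝ≥0) → Finset E} (hx : MonotoneAlloc x) {e : E} {v : E → ℝ≥0}
    (he : e ∈ x v) : criticalValue x e v ≤ v e := by
  calc criticalValue x e v ≤ volume (Set.Ioc (0 : ℝ) (v e)) := by
        refine measure_mono fun z hz => ⟨hz.1, ?_⟩
        by_contra h
        exact hz.2 (hx _ e v _ he (NNReal.le_toNNReal_of_coe_le (not_le.1 h).le))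
    _ = v e := by simp [ENNReal.ofReal]

lemma le_criticalValue [DecidableEq E] {x : (E → ℝ≥0) → Finset E} {e : E} {v : E → ℝ≥0} {c : ℝ≥0}
    (h : ∀ z < c, e ∉ x (Function.update v e z)) : (c : ℝ≥0∞) ≤ criticalValue x e v := by
  rename_i inst
  obtain rfl : inst = fun a b => Classical.propDecidable (a = b) := Subsingleton.elim _ _
  classical
  calc (c : ℝ≥0∞) = volume (Set.Ioo (0 : ℝ) c) := by simp [ENNReal.ofReal]
    _ ≤ criticalValue x e v := by
        refine measure_mono fun z hz => ⟨hz.1, h _ ?_⟩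
        rw [← NNReal.coe_lt_coe, Real.coe_toNNReal z hz.1.le]
        exact hz.2

lemma criticalValue_congr {x : (E → ℝ≥0) → Finset E} {e : E} {v w : E → ℝ≥0}
    (h : ∀ e', e' ≠ e → w e' = v e') : criticalValue x e w = criticalValue x e v := by
  classical
  have : ∀ z, Function.update w e z = Function.update v e z := by
    intro z
    ext e'
    by_cases he : e' = e
    · subst he; simp
    · simp [he, h e' he]
  simp only [criticalValue, this]

lemma criticalPayment_ne_top {x : (E → ℝ≥0) → Finset E} (hx : MonotoneAlloc x) (e : E)
    (v : E → ℝ≥0) : criticalPayment x e v ≠ ∞ := by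
  unfold criticalPayment
  split_ifs with h
  · exact ((criticalValue_le hx h).trans_lt ENNReal.coe_lt_top).ne
  · simp

/-- A critical value is the volume of a section of a measurable set, hence measurable. The parameter
in `Θ` will be the threshold, over which Tonelli is applied. -/
lemma measurable_criticalPayment {Θ : Type*} [MeasurableSpace Θ]
    {x : Θ → (E → ℝ≥0) → Finset E} {e : E}
    (hx : MeasurableSet {p : Θ × (E → ℝ≥0) | e ∈ x p.1 p.2}) :
    Measurable fun p : Θ × (E → ℝ≥0) => criticalPayment (x p.1) e p.2 := by
  classical
  refine Measurable.ite hx ?_ measurable_const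
  have hupd : Measurable fun p : (Θ × (E → ℝ≥0)) × ℝ =>
      (p.1.1, Function.update p.1.2 e p.2.toNNReal) := by
    refine measurable_fst.fst.prodMk (measurable_pi_lambda _ fun a => ?_)
    by_cases ha : a = e
    · subst ha
      simpa using measurable_snd.real_toNNReal
    · simp only [ne_eq, ha, not_false_eq_true, Function.update_of_ne]
      exact (measurable_pi_apply a).comp measurable_fst.snd
  have hs : MeasurableSet {p : (Θ × (E → ℝ≥0)) × ℝ |
      0 < p.2 ∧ e ∉ x p.1.1 (Function.update p.1.2 e p.2.toNNReal)} :=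
    (measurableSet_lt measurable_const measurable_snd).inter (hupd hx).compl
  exact measurable_measure_prodMk_left hs

/-- The mechanism with a given allocation rule and critical payments. -/
noncomputable def criticalMechanism (P : BSMD E) (x : (E → ℝ≥0) → Finset E)
    (hfeas : ∀ v, x v ∈ P.feasible) (hmeas : ∀ e, MeasurableSet {v | e ∈ x v}) :
    P.Mechanism where
  alloc := x
  payment e v := (criticalPayment x e v).toReal
  alloc_feasible := hfeas
  measurable_alloc := hmeas
  measurable_payment e := by
    have : MeasurableSet {p : Unit × (E → ℝ≥0) | e ∈ x p.2} := measurable_snd (hmeas e)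
    exact ((measurable_criticalPayment (x := fun _ => x) this).comp
      (measurable_const (a := ()) |>.prodMk measurable_id)).ennreal_toReal

/-- The critical value depends only on the other bids. It is at most the true value if the truth
wins, and at least the true value if the truth loses, since then all lower bids lose too. -/
lemma criticalMechanism_isTruthful {P : BSMD E} {x : (E → ℝ≥0) → Finset E}
    (hfeas : ∀ v, x v ∈ P.feasible) (hmeas : ∀ e, MeasurableSet {v | e ∈ x v})
    (hx : MonotoneAlloc x) : (criticalMechanism P x hfeas hmeas).IsTruthful := by
  classical
  have le_of_mem : ∀ {e v}, e ∈ x v → (criticalValue x e v).toReal ≤ v e := fun he =>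
    ENNReal.toReal_le_coe_of_le_coe (criticalValue_le hx he)
  have hnonneg : ∀ (e : E) (v : E → ℝ≥0),
      0 ≤ (criticalMechanism P x hfeas hmeas).utility e (v e) v := by
    intro e v
    by_cases h : e ∈ x v
    · simpa [BSMD.Mechanism.utility, criticalMechanism, criticalPayment, h] using le_of_mem h
    · simp [BSMD.Mechanism.utility, criticalMechanism, criticalPayment, h]
  refine ⟨fun e v b hb => ?_, hnonneg⟩
  by_cases heb : e ∈ x b
  · have hcrit := criticalValue_congr (x := x) hb
    by_cases hev : e ∈ x v
    · simp [BSMD.Mechanism.utility, criticalMechanism, criticalPayment, heb, hev, hcrit]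
    · refine le_trans ?_ (hnonneg e v)
      simp only [BSMD.Mechanism.utility, criticalMechanism, criticalPayment, heb, if_true]
      rw [sub_nonpos, ← ENNReal.coe_toReal (v e)]
      refine ENNReal.toReal_mono ((criticalValue_le hx heb).trans_lt ENNReal.coe_lt_top).ne ?_
      rw [hcrit]
      refine le_criticalValue fun z hz he => hev ?_
      have := hx (fun _ _ => Classical.propDecidable _) e _ (v e) he (by simpa using hz.le)
      simpa using this
  · refine le_trans ?_ (hnonneg e v)
    simp [BSMD.Mechanism.utility, criticalMechanism, criticalPayment, heb]

/-- The revenue with critical payments is a lower bound for the revenue of Myerson's mechanism. -/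
lemma lintegral_criticalPayment_le_myersonRevenue [Fintype E] {P : BSMD E}
    {x : (E → ℝ≥0) → Finset E}
    (hfeas : ∀ v, x v ∈ P.feasible) (hmeas : ∀ e, MeasurableSet {v | e ∈ x v})
    (hx : MonotoneAlloc x) :
    ((∫⁻ v, ∑ e, criticalPayment x e v ∂P.law : ℝ≥0∞) : EReal) ≤ P.myersonRevenue := by
  have hrev : (criticalMechanism P x hfeas hmeas).expectedRevenue =
      ((∫⁻ v, ∑ e, criticalPayment x e v ∂P.law : ℝ≥0∞) : EReal) := by
    have h1 : ∀ v, ENNReal.ofReal (∑ e, (criticalPayment x e v).toReal) =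
        ∑ e, criticalPayment x e v := fun v => by
      rw [ENNReal.ofReal_sum_of_nonneg fun _ _ => ENNReal.toReal_nonneg]
      exact Finset.sum_congr rfl fun e _ =>
        ENNReal.ofReal_toReal (criticalPayment_ne_top hx e v)
    have h2 : ∀ v, ENNReal.ofReal (-∑ e, (criticalPayment x e v).toReal) = 0 := fun v =>
      ENNReal.ofReal_of_nonpos
        (neg_nonpos.2 (Finset.sum_nonneg fun _ _ => ENNReal.toReal_nonneg))
    simp [BSMD.Mechanism.expectedRevenue, extExpectation, criticalMechanism, h1, h2]
  rw [← hrev]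
  exact le_iSup₂_of_le _ (criticalMechanism_isTruthful hfeas hmeas hx) le_rfl

end CriticalPayment

/-! ### The area under an allocation probability -/

section Area

/-- If `q` is a subgradient of `u`, then the integral of `q` is at most the increment of `u`. -/
lemma lintegral_subgradient_le {u q : ℝ≥0 → ℝ} (hu : ∀ a b, u a + q a * (b - a) ≤ u b)
    (hq0 : ∀ a, 0 ≤ q a) (hq1 : ∀ a, q a ≤ 1) (hu0 : ∀ a, 0 ≤ u a) (b : ℝ≥0) :
    ∫⁻ z in Set.Ioc (0 : ℝ) b, ENNReal.ofReal (q z.toNNReal) ≤ ENNReal.ofReal (u b) := by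
  have hle : ∀ a b, a ≤ b → u b ≤ u a + (b - a) := by
    intro a b hab
    have h1 := hu b a
    have h2 : (a : ℝ) ≤ b := by exact_mod_cast hab
    nlinarith [hq1 b, hq0 b]
  have humono : Monotone u := by
    intro a b hab
    have h2 : (a : ℝ) ≤ b := by exact_mod_cast hab
    nlinarith [hu a b, hq0 a]
  have hqmono : Monotone q := by
    intro a b hab
    rcases hab.eq_or_lt with rfl | hab
    · rfl
    have h2 : (a : ℝ) < b := by exact_mod_cast hab
    nlinarith [hu a b, hu b a]
  have hUmono : Monotone fun z : ℝ => u z.toNNReal := humono.comp fun _ _ h => Real.toNNReal_mono h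
  have hQmono : Monotone fun z : ℝ => q z.toNNReal := hqmono.comp fun _ _ h => Real.toNNReal_mono h
  have hUint : ∀ c d : ℝ, IntervalIntegrable (fun z : ℝ => u z.toNNReal) volume c d :=
    fun c d => hUmono.intervalIntegrable
  have hQint : ∀ c d : ℝ, IntervalIntegrable (fun z : ℝ => q z.toNNReal) volume c d :=
    fun c d => hQmono.intervalIntegrable
  have hb : (0 : ℝ) ≤ b := b.2
  have hmain : ∫ z in (0 : ℝ)..b, q z.toNNReal ≤ u b := by
    -- Integrate `δ q(z) ≤ u(z + δ) - u(z)` over `[0, b]`: the right side telescopes to at most the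
    -- integral of `u` over `[b, b + δ]`, where `u ≤ u b + δ`. Divide by `δ`; no differentiability
    -- is needed.
    refine le_of_forall_pos_le_add fun δ hδ => ?_
    have h1 : δ * ∫ z in (0 : ℝ)..b, q z.toNNReal ≤
        (∫ z in (0 : ℝ)..b, u (z + δ).toNNReal) - ∫ z in (0 : ℝ)..b, u z.toNNReal := by
      have hUint' : IntervalIntegrable (fun z : ℝ => u (z + δ).toNNReal) volume 0 b :=
        (hUmono.comp (fun _ _ h => by simpa using h :
          Monotone fun z : ℝ => z + δ)).intervalIntegrable
      rw [← intervalIntegral.integral_const_mul, ← intervalIntegral.integral_sub hUint' (hUint _ _)]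
      refine intervalIntegral.integral_mono_on hb ((hQint _ _).const_mul δ)
        (hUint'.sub (hUint _ _)) fun z hz => ?_
      have := hu z.toNNReal (z + δ).toNNReal
      rw [Real.coe_toNNReal _ hz.1, Real.coe_toNNReal _ (add_nonneg hz.1 hδ.le)] at this
      linarith
    have h2 : (∫ z in (0 : ℝ)..b, u (z + δ).toNNReal) = ∫ z in (0 + δ)..(b + δ), u z.toNNReal :=
      intervalIntegral.integral_comp_add_right (fun z : ℝ => u z.toNNReal) δ
    have h3 := intervalIntegral.integral_add_adjacent_intervals (hUint 0 (0 + δ)) (hUint (0 + δ) (b + δ))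
    have h4 := intervalIntegral.integral_add_adjacent_intervals (hUint 0 b) (hUint b (b + δ))
    have h5 : 0 ≤ ∫ z in (0 : ℝ)..(0 + δ), u z.toNNReal :=
      intervalIntegral.integral_nonneg (by linarith) fun z _ => hu0 _
    have h6 : ∫ z in (b : ℝ)..(b + δ), u z.toNNReal ≤ ∫ z in (b : ℝ)..(b + δ), (u b + δ) := by
      refine intervalIntegral.integral_mono_on (by linarith) (hUint _ _) (by simp) fun z hz => ?_
      have hz0 : 0 ≤ z := hb.trans hz.1
      have := hle b z.toNNReal (NNReal.le_toNNReal_of_coe_le hz.1)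
      rw [Real.coe_toNNReal _ hz0] at this
      linarith [hz.2]
    rw [intervalIntegral.integral_const, smul_eq_mul] at h6
    have h7 : δ * ∫ z in (0 : ℝ)..b, q z.toNNReal ≤ δ * (u b + δ) := by
      have : ((b : ℝ) + δ - b) = δ := by ring
      rw [this] at h6
      linarith
    exact le_of_mul_le_mul_left h7 hδ
  rw [← ofReal_integral_eq_lintegral_ofReal ((hQint 0 b).1) (ae_of_all _ fun z => hq0 _),
    ← intervalIntegral.integral_of_le hb]
  exact ENNReal.ofReal_le_ofReal hmain

lemma volume_Ioo_inter_lt {c : ℝ} (hc : c ≤ 1) :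
    ∫⁻ θ in Set.Ioo (0 : ℝ) 1, (if θ < c then 1 else 0 : ℝ≥0∞) = ENNReal.ofReal c := by
  have : (fun θ : ℝ => (if θ < c then 1 else 0 : ℝ≥0∞)) = (Set.Iio c).indicator 1 := by
    ext θ
    simp [Set.indicator]
  rw [this, lintegral_indicator_one measurableSet_Iio, Measure.restrict_apply measurableSet_Iio,
    Set.inter_comm, Set.Ioo_inter_Iio, min_eq_right hc, Real.volume_Ioo, sub_zero]

open Classical in
/-- Serving the pairs of `T` with probability `q` extracts all of the value but the utility. -/
lemma ofReal_mul_le_lintegral_criticalPayment {E : Type*} [DecidableEq E] (T : (E → ℝ≥0) → Finset E)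
    (q : (E → ℝ≥0) → E → ℝ) {u : (E → ℝ≥0) → ℝ} {e : E} {v : E → ℝ≥0}
    (hu : ∀ a b, u (Function.update v e a) + q (Function.update v e a) e * (b - a) ≤
      u (Function.update v e b))
    (hq0 : ∀ w, 0 ≤ q w e) (hq1 : ∀ w, q w e ≤ 1) (hu0 : ∀ w, 0 ≤ u w) (he : e ∈ T v) :
    ENNReal.ofReal (q v e * v e) ≤
      (∫⁻ θ in Set.Ioo (0 : ℝ) 1, criticalPayment (fun w => (T w).filter fun a => θ < q w a) e v) +
        ENNReal.ofReal (u v) := by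
  rename_i inst
  obtain rfl : inst = fun a b => Classical.propDecidable (a = b) := Subsingleton.elim _ _
  classical
  set Q : ℝ → ℝ := fun z => q (Function.update v e z.toNNReal) e with hQ
  have hQmono : Monotone Q := by
    intro a b hab
    rcases (Real.toNNReal_mono hab).eq_or_lt with h | h
    · simp only [hQ, h, le_refl]
    have h2 : (a.toNNReal : ℝ) < b.toNNReal := by exact_mod_cast h
    have h3 := hu a.toNNReal b.toNNReal
    have h4 := hu b.toNNReal a.toNNReal
    simp only [hQ]
    nlinarith
  have hmeas : Measurable fun p : ℝ × ℝ => (if p.1 < Q p.2 then 1 else 0 : ℝ≥0∞) :=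
    Measurable.ite (measurableSet_lt measurable_fst (hQmono.measurable.comp measurable_snd))
      measurable_const measurable_const
  -- For a served pair, `(0, v e]` is covered by losing bids, counted in the critical value, and
  -- bids with `q > θ`. Averaged over `θ`, the latter give the area under `q`.
  have hpt : ∀ θ : ℝ, (v e : ℝ≥0∞) * (if θ < q v e then 1 else 0) ≤
      criticalPayment (fun w => (T w).filter fun a => θ < q w a) e v +
        ∫⁻ z in Set.Ioc (0 : ℝ) (v e), (if θ < Q z then 1 else 0) := by
    intro θ
    split_ifs with hθ
    · have hmem : e ∈ (T v).filter fun a => θ < q v a := Finset.mem_filter.2 ⟨he, hθ⟩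
      rw [criticalPayment, if_pos hmem, criticalValue, mul_one]
      have hQm : MeasurableSet {z : ℝ | θ < Q z} :=
        measurableSet_lt measurable_const hQmono.measurable
      have : (fun z : ℝ => (if θ < Q z then 1 else 0 : ℝ≥0∞)) = {z | θ < Q z}.indicator 1 := by
        ext z
        simp [Set.indicator]
      rw [this, lintegral_indicator_one hQm, Measure.restrict_apply hQm]
      calc (v e : ℝ≥0∞) = volume (Set.Ioc (0 : ℝ) (v e)) := by simp [ENNReal.ofReal]
        _ ≤ _ := (measure_mono fun z hz => ?_).trans (measure_union_le _ _)
      by_cases hz' : θ < Q z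
      · exact Or.inr ⟨hz', hz⟩
      · exact Or.inl ⟨hz.1, fun h => hz' (Finset.mem_filter.1 h).2⟩
    · simp
  calc ENNReal.ofReal (q v e * v e)
      = ∫⁻ θ in Set.Ioo (0 : ℝ) 1, (v e : ℝ≥0∞) * (if θ < q v e then 1 else 0) := by
        rw [lintegral_const_mul' _ _ ENNReal.coe_ne_top, volume_Ioo_inter_lt (hq1 v), mul_comm (q v e),
          ENNReal.ofReal_mul (v e).coe_nonneg, ENNReal.ofReal_coe_nnreal]
    _ ≤ ∫⁻ θ in Set.Ioo (0 : ℝ) 1,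
          (criticalPayment (fun w => (T w).filter fun a => θ < q w a) e v +
            ∫⁻ z in Set.Ioc (0 : ℝ) (v e), (if θ < Q z then 1 else 0)) :=
        lintegral_mono fun θ => hpt θ
    _ = (∫⁻ θ in Set.Ioo (0 : ℝ) 1,
          criticalPayment (fun w => (T w).filter fun a => θ < q w a) e v) +
        ∫⁻ z in Set.Ioc (0 : ℝ) (v e), ENNReal.ofReal (Q z) := by
        rw [lintegral_add_right _ hmeas.lintegral_prod_right', lintegral_lintegral_swap
          hmeas.aemeasurable]
        congr 1
        exact lintegral_congr fun z => volume_Ioo_inter_lt (hq1 (Function.update v e z.toNNReal))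
    _ ≤ _ := by
        gcongr
        have := lintegral_subgradient_le (u := fun z => u (Function.update v e z))
          (q := fun z => q (Function.update v e z) e) hu (fun _ => hq0 _) (fun _ => hq1 _)
          (fun _ => hu0 _) (v e)
        simpa using this

end Area

/-! ### A layer cake inequality -/

section LayerCake

open Classical in
/-- If the weights on all upper level sets of `a` are dominated by the number of elements of `H`
in the corresponding upper level sets of `c`, then the weighted sum of `a` is at most the sum of
`c`. -/
lemma sum_ofReal_mul_le_of_levels {α β : Type*} (N : Finset α) (H : Finset β) (q : α → ℝ)
    (a : α → ℝ≥0) (c : β → ℝ≥0∞) (hq : ∀ f ∈ N, 0 ≤ q f)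
    (h : ∀ t : ℝ≥0, ∑ f ∈ N.filter (fun f => t ≤ a f), q f ≤
      ((H.filter fun b => (t : ℝ≥0∞) ≤ c b).card : ℝ)) :
    ∑ f ∈ N, ENNReal.ofReal (q f * a f) ≤ ∑ b ∈ H, c b := by
  -- Layer cake for a single number, including `s = ∞`.
  have hind : ∀ s : ℝ≥0∞, ∫⁻ t in Set.Ioi (0 : ℝ), (if ENNReal.ofReal t ≤ s then 1 else 0 : ℝ≥0∞) = s := by
    intro s
    have hm : MeasurableSet {t : ℝ | ENNReal.ofReal t ≤ s} :=
      measurableSet_le ENNReal.measurable_ofReal measurable_const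
    have : (fun t : ℝ => (if ENNReal.ofReal t ≤ s then 1 else 0 : ℝ≥0∞)) =
        {t : ℝ | ENNReal.ofReal t ≤ s}.indicator 1 := by
      ext t
      simp [Set.indicator]
    rw [this, lintegral_indicator_one hm, Measure.restrict_apply hm]
    rcases eq_or_ne s ∞ with rfl | hs
    · simp
    · have : {t : ℝ | ENNReal.ofReal t ≤ s} ∩ Set.Ioi 0 = Set.Ioc 0 s.toReal := by
        ext t
        simp only [Set.mem_inter_iff, Set.mem_ofPred_eq, Set.mem_Ioi, Set.mem_Ioc,
          ENNReal.ofReal_le_iff_le_toReal hs]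
        exact and_comm
      rw [this, Real.volume_Ioc, sub_zero, ENNReal.ofReal_toReal hs]
  have hmeas : ∀ s : ℝ≥0∞, Measurable fun t : ℝ =>
      (if ENNReal.ofReal t ≤ s then 1 else 0 : ℝ≥0∞) := fun s =>
    Measurable.ite (measurableSet_le ENNReal.measurable_ofReal measurable_const)
      measurable_const measurable_const
  calc ∑ f ∈ N, ENNReal.ofReal (q f * a f)
      = ∑ f ∈ N, ∫⁻ t in Set.Ioi (0 : ℝ),
          ENNReal.ofReal (q f) * (if ENNReal.ofReal t ≤ a f then 1 else 0) := by
        refine Finset.sum_congr rfl fun f _ => ?_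
        rw [lintegral_const_mul' _ _ ENNReal.ofReal_ne_top, hind,
          mul_comm (q f), ENNReal.ofReal_mul (a f).coe_nonneg, ENNReal.ofReal_coe_nnreal, mul_comm]
    _ = ∫⁻ t in Set.Ioi (0 : ℝ), ∑ f ∈ N,
          ENNReal.ofReal (q f) * (if ENNReal.ofReal t ≤ a f then 1 else 0) :=
        (lintegral_finsetSum _ fun f _ => (hmeas _).const_mul _).symm
    _ ≤ ∫⁻ t in Set.Ioi (0 : ℝ), ∑ b ∈ H, (if ENNReal.ofReal t ≤ c b then 1 else 0) := by
        refine lintegral_mono fun t => ?_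
        change (_ : ℝ≥0∞) ≤ _
        have h1 := ENNReal.ofReal_le_ofReal (h t.toNNReal)
        rw [ENNReal.ofReal_sum_of_nonneg fun f hf => hq f (Finset.mem_filter.1 hf).1,
          Finset.sum_filter] at h1
        rw [Finset.sum_boole]
        rw [← Finset.sum_filter, ENNReal.ofReal_natCast] at h1
        simp only [mul_ite, mul_one, mul_zero]
        rw [← Finset.sum_filter]
        convert h1 using 2
        · ext f
          simp [ENNReal.ofReal]
        · rfl
    _ = ∑ b ∈ H, c b := by
        rw [lintegral_finsetSum _ fun f _ => hmeas _]
        simp only [hind]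

end LayerCake

/-! ### Favorite services -/

section Favorites

variable {I J : Type*}

open Classical in
/-- The independent sets with at most two pairs for every agent. -/
def twoPerAgent (M : Matroid (I × J)) : Set (Finset (I × J)) :=
  {S | M.Indep (S : Set (I × J)) ∧ ∀ i, (S.filter fun e => e.1 = i).card ≤ 2}

lemma empty_mem_twoPerAgent (M : Matroid (I × J)) : ∅ ∈ twoPerAgent M := by
  simp [twoPerAgent]

lemma twoPerAgent_mono {M : Matroid (I × J)} (S S' : Finset (I × J)) (h : S ⊆ S')
    (h' : S' ∈ twoPerAgent M) : S ∈ twoPerAgent M := by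
  classical
  exact ⟨h'.1.subset (by exact_mod_cast h),
    fun i => (Finset.card_le_card (Finset.filter_subset_filter _ h)).trans (h'.2 i)⟩

/-- A feasible subset of `S` is independent, so it lies in the ground set and hence in the span of
`D`, whose rank is at most `D.card`. -/
lemma rank_le_card_of_subset_closure {M : Matroid (I × J)} {P : BMUMD I J}
    (hP : P.feasible = {S : Finset (I × J) | M.Indep (S : Set (I × J)) ∧ UnitDemand S})
    {S D : Finset (I × J)} (h : ∀ f ∈ S, f ∈ M.E → f ∈ M.closure (D : Set (I × J))) :
    P.rank S ≤ D.card := by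
  classical
  refine Finset.sup_le fun X hX => ?_
  rw [Finset.mem_filter, Finset.mem_powerset, hP] at hX
  have hXi : M.Indep (X : Set (I × J)) := hX.2.1
  have hsub : (X : Set (I × J)) ⊆ M.closure (D : Set (I × J)) := fun x hx =>
    h x (hX.1 hx) (hXi.subset_ground hx)
  have := hXi.encard_le_eRk_of_subset hsub
  rw [M.eRk_closure_eq] at this
  have := this.trans (M.eRk_le_encard _)
  simpa using this

variable [Fintype I] [Fintype J]

open Classical in
/-- The first pair of every agent in the greedy set with at most two pairs for every agent. -/
noncomputable def favorites (M : Matroid (I × J)) (v : I × J → ℝ≥0) : Finset (I × J) :=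
  (greedy (twoPerAgent M) v).filter fun e =>
    ∀ x ∈ greedy (twoPerAgent M) v, x.1 = e.1 → ¬ Precedes v x e

variable {M : Matroid (I × J)} {v : I × J → ℝ≥0}

lemma mem_favorites {e : I × J} : e ∈ favorites M v ↔ e ∈ greedy (twoPerAgent M) v ∧
    ∀ x ∈ greedy (twoPerAgent M) v, x.1 = e.1 → ¬ Precedes v x e := by
  classical
  simp [favorites]

lemma eq_of_mem_favorites {x y : I × J} (hx : x ∈ favorites M v) (hy : y ∈ favorites M v)
    (h : x.1 = y.1) : x = y := by
  by_contra hne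
  rw [mem_favorites] at hx hy
  rcases precedes_or (v := v) hne with h' | h'
  · exact hy.2 x hx.1 h h'
  · exact hx.2 y hy.1 h.symm h'

lemma favorites_indep : M.Indep (favorites M v : Set (I × J)) :=
  (greedy_mem (empty_mem_twoPerAgent M) v).1.subset fun _ he => (mem_favorites.1 he).1

lemma favorites_unitDemand : UnitDemand (favorites M v) := fun _ _ _ hj hk =>
  congrArg Prod.snd (eq_of_mem_favorites hj hk rfl)

/-- Raising a favorite leaves the greedy set unchanged and only moves the favorite forward among the
pairs of its agent. -/
lemma favorites_monotoneAlloc : MonotoneAlloc (favorites M) := by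
  intro _ e v z he hz
  rw [mem_favorites] at he ⊢
  rw [greedy_update_eq (empty_mem_twoPerAgent M) twoPerAgent_mono he.1 hz]
  refine ⟨he.1, fun x hx hxe h => ?_⟩
  have h' := (precedes_or h.ne).resolve_left (he.2 x hx hxe)
  exact lt_asymm h (h'.update hz h.ne)

lemma measurableSet_mem_favorites (e : I × J) : MeasurableSet {v | e ∈ favorites M v} := by
  let s : Set (I × J → I × J → Prop) := {r | e ∈ greedyOf (twoPerAgent M) r ∧
    ∀ x ∈ greedyOf (twoPerAgent M) r, x.1 = e.1 → ¬ r x e}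
  have : {v | e ∈ favorites M v} = {v : I × J → ℝ≥0 | Precedes v ∈ s} :=
    Set.ext fun v => mem_favorites
  rw [this]
  exact measurableSet_precedes s

lemma exists_favorite {h : I × J} (hh : h ∈ greedy (twoPerAgent M) v) :
    ∃ g ∈ favorites M v, g.1 = h.1 := by
  classical
  obtain ⟨g, hg, hmin⟩ := Finset.exists_min_image
    ((greedy (twoPerAgent M) v).filter fun e => e.1 = h.1) (priority v)
    ⟨h, Finset.mem_filter.2 ⟨hh, rfl⟩⟩
  rw [Finset.mem_filter] at hg
  exact ⟨g, mem_favorites.2 ⟨hg.1, fun x hx hxg => not_lt.2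
    (hmin x (Finset.mem_filter.2 ⟨hx, hxg.trans hg.2⟩))⟩, hg.2⟩

/-- The critical payments of an agent when favorites are served. -/
noncomputable def agentPayment (M : Matroid (I × J)) (v : I × J → ℝ≥0) (i : I) : ℝ≥0∞ :=
  ∑ j, criticalPayment (favorites M) (i, j) v

open Classical in
lemma le_agentPayment {g : I × J} (hg : g ∈ favorites M v) {c : ℝ≥0}
    (h : ∀ z < c, g ∉ favorites M (Function.update v g z)) :
    (c : ℝ≥0∞) ≤ agentPayment M v g.1 :=
  calc (c : ℝ≥0∞) ≤ criticalPayment (favorites M) (g.1, g.2) v := by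
        rw [criticalPayment, if_pos hg]
        exact le_criticalValue h
    _ ≤ agentPayment M v g.1 :=
        Finset.single_le_sum (f := fun j => criticalPayment (favorites M) (g.1, j) v)
          (fun _ _ => zero_le) (Finset.mem_univ g.2)

/-- An agent pays at least her second value in the greedy set. -/
lemma le_agentPayment_of_second {g s : I × J} (hg : g ∈ favorites M v)
    (hs : s ∈ greedy (twoPerAgent M) v) (hsg : s.1 = g.1) (hne : s ≠ g) :
    (v s : ℝ≥0∞) ≤ agentPayment M v g.1 := by
  classical
  refine le_agentPayment hg fun z hz hmem => ?_
  rw [mem_favorites] at hg hmem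
  have hgs : Precedes v g s := (precedes_or hne).resolve_left (hg.2 s hs hsg)
  -- Were `g` still a favorite at the bid `z`, raising it back would show that the greedy set is
  -- unchanged, so it contains `s`, which now precedes `g`.
  have hG := greedy_update_eq (empty_mem_twoPerAgent M) twoPerAgent_mono hmem.1
    (z := v g) (by simpa using hz.le.trans hgs.le)
  simp only [Function.update_idem, Function.update_eq_self] at hG
  rw [← hG] at hmem
  exact hmem.2 s hs hsg (precedes_of_lt (by simpa [hne] using hz))

/-- At least one of the two pairs is not the favorite, so `le_agentPayment_of_second` applies to it.
-/
lemma le_agentPayment_of_two {x y : I × J} (hx : x ∈ greedy (twoPerAgent M) v)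
    (hy : y ∈ greedy (twoPerAgent M) v) (hxy : x.1 = y.1) (hne : x ≠ y) {c : ℝ≥0}
    (hcx : c ≤ v x) (hcy : c ≤ v y) : (c : ℝ≥0∞) ≤ agentPayment M v x.1 := by
  obtain ⟨g, hg, hgx⟩ := exists_favorite hx
  rw [← hgx]
  by_cases h : x = g
  · subst h
    exact (ENNReal.coe_le_coe.2 hcy).trans (le_agentPayment_of_second hg hy hxy.symm hne.symm)
  · exact (ENNReal.coe_le_coe.2 hcx).trans (le_agentPayment_of_second hg hx hgx.symm h)

open Classical in
/-- The agent of a pair whose removal from the greedy set unblocks `f` pays at least the value of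
`f`. -/
lemma le_agentPayment_of_pivotal {h f : I × J} (hh : h ∈ greedy (twoPerAgent M) v)
    (hf : f ∉ greedy (twoPerAgent M) v) (hhf : Precedes v h f)
    (hpiv : insert f (((greedy (twoPerAgent M) v).filter fun x => Precedes v x f).erase h) ∈
      twoPerAgent M) : (v f : ℝ≥0∞) ≤ agentPayment M v h.1 := by
  obtain ⟨g, hg, hgh⟩ := exists_favorite hh
  rw [← hgh]
  by_cases hne : h = g
  · subst hne
    exact le_agentPayment hg fun z hz hmem => notMem_greedy_update (empty_mem_twoPerAgent M)
      twoPerAgent_mono hf hhf hpiv hz (mem_favorites.1 hmem).1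
  · exact (ENNReal.coe_le_coe.2 hhf.le).trans
      (le_agentPayment_of_second hg hh hgh.symm hne)

/-- The agent of `f` has two pairs in the greedy set that are worth at least as much as `f`. -/
def IsDominated (M : Matroid (I × J)) (v : I × J → ℝ≥0) (f : I × J) : Prop :=
  ∃ x ∈ greedy (twoPerAgent M) v, ∃ y ∈ greedy (twoPerAgent M) v,
    x ≠ y ∧ x.1 = f.1 ∧ y.1 = f.1 ∧ v f ≤ v x ∧ v f ≤ v y

lemma IsDominated.le_agentPayment {f : I × J} (h : IsDominated M v f) :
    (v f : ℝ≥0∞) ≤ agentPayment M v f.1 := by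
  obtain ⟨x, hx, y, hy, hne, hxf, hyf, h1, h2⟩ := h
  rw [← hxf]
  exact le_agentPayment_of_two hx hy (hxf.trans hyf.symm) hne h1 h2

/-- A pair that is neither a favorite nor dominated is spanned by pairs of the greedy set whose
agents pay at least its value. -/
lemma mem_closure_of_not_isDominated {f : I × J} (hf : f ∉ favorites M v)
    (hd : ¬ IsDominated M v f) (hfE : f ∈ M.E) :
    f ∈ M.closure {h | h ∈ greedy (twoPerAgent M) v ∧ (v f : ℝ≥0∞) ≤ agentPayment M v h.1} := by
  classical
  set G := greedy (twoPerAgent M) v with hG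
  have hGF : G ∈ twoPerAgent M := greedy_mem (empty_mem_twoPerAgent M) v
  have hfG : f ∉ G := by
    intro hfG
    refine hf (mem_favorites.2 ⟨hfG, fun x hx hxf h => hd ?_⟩)
    -- A non-favorite of `G` is dominated by an earlier pair of its agent together with itself.
    exact ⟨x, hx, f, hfG, h.ne, hxf, rfl, h.le, le_rfl⟩
  set K := G.filter fun x => Precedes v x f with hK
  have hfK : f ∉ K := fun h => hfG (Finset.mem_filter.1 h).1
  have hKF : K ∈ twoPerAgent M := twoPerAgent_mono _ _ (Finset.filter_subset _ _) hGF
  have hcard : ∀ i, ((insert f K).filter fun e => e.1 = i).card ≤ 2 := by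
    intro i
    rw [Finset.filter_insert]
    split_ifs with hi
    · refine (Finset.card_insert_le _ _).trans (Nat.succ_le_succ (Finset.card_le_one.2 ?_))
      intro a ha b hb
      simp only [hK, Finset.mem_filter] at ha hb
      by_contra hab
      exact hd ⟨a, ha.1.1, b, hb.1.1, hab, ha.2.trans hi.symm, hb.2.trans hi.symm,
        ha.1.2.le, hb.1.2.le⟩
    · exact hKF.2 i
  -- By `hcard` the two-per-agent quota does not exclude `f`, so the matroid does.
  have hblock : ¬ M.Indep (insert f (K : Set (I × J))) := fun h =>
    hfG (mem_greedy_iff.2 (show insert f K ∈ twoPerAgent M from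
      ⟨by rwa [Finset.coe_insert], hcard⟩))
  have hcl : f ∈ M.closure (K : Set (I × J)) := by
    by_contra h
    exact hblock ((hKF.1.notMem_closure_iff_of_notMem (by simpa using hfK) hfE).1 h)
  have hC := hKF.1.fundCircuit_isCircuit hcl (by simpa using hfK)
  refine M.closure_subset_closure ?_
    (hC.mem_closure_sdiff_singleton_of_mem (M.mem_fundCircuit f K))
  rintro h ⟨hh, hhf⟩
  have hhf : h ≠ f := hhf
  have hhK : h ∈ K := by
    simpa [hhf] using M.fundCircuit_subset_insert f K hh
  -- Exchanging `h` for `f` keeps independence, so `h` is pivotal for `f`.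
  have hind := (hKF.1.mem_fundCircuit_iff hcl (by simpa using hfK)).1 hh
  refine ⟨(Finset.mem_filter.1 hhK).1, le_agentPayment_of_pivotal (Finset.mem_filter.1 hhK).1 hfG
    (Finset.mem_filter.1 hhK).2 ⟨?_, fun i => ?_⟩⟩
  · refine hind.subset fun x hx => ?_
    simp only [Finset.coe_insert, Finset.coe_erase, Set.mem_insert_iff, Set.mem_sdiff,
      Set.mem_singleton_iff] at hx ⊢
    rcases hx with rfl | hx
    · exact ⟨Or.inl rfl, hhf.symm⟩
    · exact ⟨Or.inr hx.1, hx.2⟩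
  · refine (Finset.card_le_card (Finset.filter_subset_filter _ ?_)).trans (hcard i)
    exact Finset.insert_subset_insert _ (Finset.erase_subset _ _)

open Classical in
/-- The value of the pairs that are not favorites is at most three times the critical payments. -/
lemma sum_notMem_favorites_le {P : BMUMD I J}
    (hP : P.feasible = {S : Finset (I × J) | M.Indep (S : Set (I × J)) ∧ UnitDemand S})
    {q : I × J → ℝ} (hq0 : ∀ e, 0 ≤ q e) (hq1 : ∀ i, ∑ j, q (i, j) ≤ 1)
    (hq : ∀ S : Finset (I × J), ∑ e ∈ S, q e ≤ P.rank S) :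
    ∑ f with f ∉ favorites M v, ENNReal.ofReal (q f * v f) ≤
      3 * ∑ e, criticalPayment (favorites M) e v := by
  set G := greedy (twoPerAgent M) v with hG
  have hpay : ∑ e, criticalPayment (favorites M) e v = ∑ i, agentPayment M v i :=
    Fintype.sum_prod_type _
  rw [hpay, ← Finset.sum_filter_add_sum_filter_not _ (IsDominated M v)]
  have h1 : ∑ f ∈ (Finset.univ.filter fun f => f ∉ favorites M v).filter (IsDominated M v),
      ENNReal.ofReal (q f * v f) ≤ ∑ i, agentPayment M v i := by
    calc _ ≤ ∑ f ∈ (Finset.univ.filter fun f => f ∉ favorites M v).filter (IsDominated M v),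
            ENNReal.ofReal (q f) * agentPayment M v f.1 := by
          refine Finset.sum_le_sum fun f hf => ?_
          rw [ENNReal.ofReal_mul (hq0 f), ENNReal.ofReal_coe_nnreal]
          gcongr
          exact (Finset.mem_filter.1 hf).2.le_agentPayment
      _ ≤ ∑ f : I × J, ENNReal.ofReal (q f) * agentPayment M v f.1 :=
          Finset.sum_le_sum_of_subset (Finset.subset_univ _)
      _ = ∑ i, ENNReal.ofReal (∑ j, q (i, j)) * agentPayment M v i := by
          rw [Fintype.sum_prod_type]
          refine Finset.sum_congr rfl fun i _ => ?_
          rw [ENNReal.ofReal_sum_of_nonneg fun j _ => hq0 _, Finset.sum_mul]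
      _ ≤ ∑ i, agentPayment M v i := by
          refine Finset.sum_le_sum fun i _ => mul_le_of_le_one_left zero_le ?_
          exact ENNReal.ofReal_le_one.2 (hq1 i)
  have h2 : ∑ f ∈ (Finset.univ.filter fun f => f ∉ favorites M v).filter
      (fun f => ¬ IsDominated M v f), ENNReal.ofReal (q f * v f) ≤
      2 * ∑ i, agentPayment M v i := by
    calc _ ≤ ∑ h ∈ G, agentPayment M v h.1 := by
          -- At level `t`, lottery feasibility bounds the mass by the rank, and the pairs of `G`
          -- whose agents pay at least `t` span the level set.
          refine sum_ofReal_mul_le_of_levels _ _ _ _ _ (fun f _ => hq0 f) fun t => ?_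
          refine (hq _).trans (Nat.cast_le.2 (rank_le_card_of_subset_closure hP ?_))
          intro f hf hfE
          simp only [Finset.mem_filter, Finset.mem_univ, true_and] at hf
          refine M.closure_subset_closure ?_ (mem_closure_of_not_isDominated hf.1.1 hf.1.2 hfE)
          intro h hh
          rw [Finset.mem_coe, Finset.mem_filter]
          exact ⟨hh.1, (ENNReal.coe_le_coe.2 hf.2).trans hh.2⟩
      _ = ∑ i, ∑ h ∈ G with h.1 = i, agentPayment M v h.1 :=
          (Finset.sum_fiberwise _ _ _).symm
      _ ≤ ∑ i, 2 * agentPayment M v i := by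
          refine Finset.sum_le_sum fun i _ => ?_
          rw [Finset.sum_congr rfl (g := fun _ => agentPayment M v i)
            fun h hh => by rw [(Finset.mem_filter.1 hh).2], Finset.sum_const, nsmul_eq_mul]
          gcongr
          exact_mod_cast (greedy_mem (empty_mem_twoPerAgent M) v).2 i
      _ = 2 * ∑ i, agentPayment M v i := (Finset.mul_sum _ _ _).symm
  calc _ ≤ (∑ i, agentPayment M v i) + 2 * ∑ i, agentPayment M v i := add_le_add h1 h2
    _ = 3 * ∑ i, agentPayment M v i := by ring

end Favorites

/-! ### Lottery-based mechanisms -/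

section LotteryMechanism

variable {I J : Type*} [Fintype I] [Fintype J] {P : BMUMD I J}

/-- The probability that a lottery-based mechanism serves a pair. -/
def BMUMD.LotteryMechanism.serviceProb (L : P.LotteryMechanism) (v : I × J → ℝ≥0) (e : I × J) :
    ℝ :=
  (L.choice e.1 v).prob e.2

/-- The utility of an agent in a lottery-based mechanism. -/
def BMUMD.LotteryMechanism.agentUtility (L : P.LotteryMechanism) (i : I) (v : I × J → ℝ≥0) : ℝ :=
  (L.choice i v).utility fun j => v (i, j)

variable (L : P.LotteryMechanism)

lemma serviceProb_nonneg (v : I × J → ℝ≥0) (e : I × J) : 0 ≤ L.serviceProb v e :=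
  (L.choice e.1 v).prob_nonneg e.2

lemma agentUtility_nonneg (i : I) (v : I × J → ℝ≥0) : 0 ≤ L.agentUtility i v :=
  L.choice_nonneg i v

lemma serviceProb_le_one (v : I × J → ℝ≥0) (e : I × J) : L.serviceProb v e ≤ 1 :=
  (Finset.single_le_sum (fun j _ => (L.choice e.1 v).prob_nonneg j) (Finset.mem_univ e.2)).trans
    (L.choice e.1 v).sum_prob_le_one

/-- The allocation probabilities are subgradients of the utility. -/
lemma agentUtility_add_le [DecidableEq (I × J)] (v : I × J → ℝ≥0) (e : I × J) (a b : ℝ≥0) :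
    L.agentUtility e.1 (Function.update v e a) +
      L.serviceProb (Function.update v e a) e * (b - a) ≤
        L.agentUtility e.1 (Function.update v e b) := by
  set va := Function.update v e a with hva
  set vb := Function.update v e b with hvb
  have hmenu : L.menu e.1 va = L.menu e.1 vb := by
    refine L.menu_congr _ _ _ fun k hk j => ?_
    have : (k, j) ≠ e := fun h => hk (congrArg Prod.fst h)
    simp [hva, hvb, this]
  -- The lottery chosen at `va` is still available at `vb`, because the menu ignores the agent's own
  -- values.
  have h1 : (L.choice e.1 va).utility (fun j => vb (e.1, j)) ≤ L.agentUtility e.1 vb := by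
    rcases L.choice_mem e.1 va with h | h
    · exact L.choice_optimal e.1 vb _ (hmenu ▸ h)
    · rw [h]
      refine le_trans (le_of_eq ?_) (L.choice_nonneg e.1 vb)
      simp [Lottery.utility, Lottery.none]
  refine le_trans (le_of_eq ?_) h1
  have h2 : ∑ j, (L.choice e.1 va).prob j * ((vb (e.1, j) : ℝ) - va (e.1, j)) =
      (L.choice e.1 va).prob e.2 * (b - a) := by
    rw [Finset.sum_eq_single e.2]
    · simp [hva, hvb]
    · intro j _ hj
      have : (e.1, j) ≠ e := fun h => hj (congrArg Prod.snd h)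
      simp [hva, hvb, this]
    · simp
  simp only [mul_sub, Finset.sum_sub_distrib] at h2
  simp only [BMUMD.LotteryMechanism.agentUtility, BMUMD.LotteryMechanism.serviceProb,
    Lottery.utility]
  linarith

open Classical in
/-- Serve the favorites that are served with probability more than `θ` by the lotteries. -/
noncomputable def thresholdAlloc (M : Matroid (I × J)) (θ : ℝ) (v : I × J → ℝ≥0) :
    Finset (I × J) :=
  (favorites M v).filter fun e => θ < L.serviceProb v e

variable {M : Matroid (I × J)}

lemma thresholdAlloc_feasible
    (hP : P.feasible = {S : Finset (I × J) | M.Indep (S : Set (I × J)) ∧ UnitDemand S})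
    (θ : ℝ) (v : I × J → ℝ≥0) : thresholdAlloc L M θ v ∈ P.copies.feasible := by
  classical
  have hsub : thresholdAlloc L M θ v ⊆ favorites M v := Finset.filter_subset _ _
  change _ ∈ P.feasible
  rw [hP]
  exact ⟨favorites_indep.subset (by exact_mod_cast hsub), fun i j k hj hk =>
    favorites_unitDemand i j k (hsub hj) (hsub hk)⟩

lemma measurableSet_mem_thresholdAlloc (e : I × J) :
    MeasurableSet {p : ℝ × (I × J → ℝ≥0) | e ∈ thresholdAlloc L M p.1 p.2} := by
  classical
  simp only [thresholdAlloc, Finset.mem_filter]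
  exact (measurable_snd (measurableSet_mem_favorites e)).inter
    (measurableSet_lt measurable_fst ((L.measurable_prob e.1 e.2).comp measurable_snd))

/-- Adding the subgradient inequalities at the two bids shows that `q_e` is nondecreasing in `v_e`.
-/
lemma thresholdAlloc_monotone (θ : ℝ) : MonotoneAlloc (thresholdAlloc L M θ) := by
  classical
  intro _ e v z he hz
  rw [thresholdAlloc, Finset.mem_filter] at he ⊢
  refine ⟨favorites_monotoneAlloc _ e v z he.1 hz, he.2.trans_le ?_⟩
  rcases hz.eq_or_lt with rfl | hz
  · simp
  have h1 := agentUtility_add_le L v e (v e) z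
  have h2 := agentUtility_add_le L v e z (v e)
  rw [Function.update_eq_self] at h1 h2
  have h3 : (v e : ℝ) < z := by exact_mod_cast hz
  nlinarith

/-- The revenue of serving favorites above a threshold. -/
lemma lintegral_thresholdAlloc_le
    (hP : P.feasible = {S : Finset (I × J) | M.Indep (S : Set (I × J)) ∧ UnitDemand S}) (θ : ℝ) :
    ∫⁻ v, ∑ e, criticalPayment (thresholdAlloc L M θ) e v ∂P.law ≤
      P.copies.myersonRevenue.toENNReal := by
  have h := lintegral_criticalPayment_le_myersonRevenue (P := P.copies)
    (thresholdAlloc_feasible L hP θ)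
    (fun e => (measurable_const (a := θ)).prodMk measurable_id
      (measurableSet_mem_thresholdAlloc (M := M) L e))
    (thresholdAlloc_monotone L θ)
  have h' := EReal.toENNReal_le_toENNReal h
  rwa [EReal.toENNReal_coe] at h'

/-- A negative threshold excludes nothing, so the same revenue bound also covers serving all
favorites. -/
lemma thresholdAlloc_neg_one : thresholdAlloc L M (-1) = favorites M := by
  classical
  ext v e
  simp only [thresholdAlloc, Finset.mem_filter, and_iff_left_iff_imp]
  intro _
  linarith [serviceProb_nonneg L v e]

/-- The prices of the lotteries are covered by critical payments. -/
lemma ofReal_sum_price_le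
    (hP : P.feasible = {S : Finset (I × J) | M.Indep (S : Set (I × J)) ∧ UnitDemand S})
    (v : I × J → ℝ≥0) :
    ENNReal.ofReal (∑ i, (L.choice i v).price) ≤
      (∫⁻ θ in Set.Ioo (0 : ℝ) 1, ∑ e, criticalPayment (thresholdAlloc L M θ) e v) +
        3 * ∑ e, criticalPayment (thresholdAlloc L M (-1)) e v := by
  classical
  have hmeas : ∀ e, Measurable fun θ : ℝ => criticalPayment (thresholdAlloc L M θ) e v :=
    fun e => Measurable.of_uncurry_right
      (f := fun (θ : ℝ) (w : I × J → ℝ≥0) => criticalPayment (thresholdAlloc L M θ) e w)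
      (measurable_criticalPayment (measurableSet_mem_thresholdAlloc L e))
  have hprice : ∑ i, (L.choice i v).price =
      ∑ e, L.serviceProb v e * v e - ∑ i, L.agentUtility i v := by
    rw [Fintype.sum_prod_type, ← Finset.sum_sub_distrib]
    refine Finset.sum_congr rfl fun i _ => ?_
    simp [BMUMD.LotteryMechanism.agentUtility, BMUMD.LotteryMechanism.serviceProb,
      Lottery.utility]
  have hterm : ∀ e, 0 ≤ L.serviceProb v e * v e := fun e =>
    mul_nonneg (serviceProb_nonneg L v e) (v e).coe_nonneg
  have hfav : ∑ e with e ∈ favorites M v, ENNReal.ofReal (L.serviceProb v e * v e) ≤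
      (∫⁻ θ in Set.Ioo (0 : ℝ) 1, ∑ e, criticalPayment (thresholdAlloc L M θ) e v) +
        ∑ i, ENNReal.ofReal (L.agentUtility i v) := by
    calc _ ≤ ∑ e with e ∈ favorites M v,
          ((∫⁻ θ in Set.Ioo (0 : ℝ) 1, criticalPayment (thresholdAlloc L M θ) e v) +
            ENNReal.ofReal (L.agentUtility e.1 v)) :=
          Finset.sum_le_sum fun e he => ofReal_mul_le_lintegral_criticalPayment (favorites M)
            L.serviceProb (agentUtility_add_le L v e) (fun w => serviceProb_nonneg L w e)
            (fun w => serviceProb_le_one L w e) (agentUtility_nonneg L e.1)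
            (Finset.mem_filter.1 he).2
      _ ≤ _ := by
          rw [Finset.sum_add_distrib, lintegral_finsetSum _ fun e _ => hmeas e]
          refine add_le_add (Finset.sum_le_sum_of_subset (Finset.subset_univ _)) ?_
          -- Agents of distinct favorites are distinct, so no utility is counted twice.
          rw [← Finset.sum_image (f := fun i => ENNReal.ofReal (L.agentUtility i v))
            (g := Prod.fst)]
          · exact Finset.sum_le_sum_of_subset (Finset.subset_univ _)
          · intro x hx y hy hxy
            exact eq_of_mem_favorites (Finset.mem_filter.1 hx).2 (Finset.mem_filter.1 hy).2 hxy
  have hrest := sum_notMem_favorites_le (v := v) hP (serviceProb_nonneg L v)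
    (fun i => (L.choice i v).sum_prob_le_one) (L.feasible v)
  rw [hprice, ENNReal.ofReal_sub _ (Finset.sum_nonneg fun i _ => agentUtility_nonneg L i v),
    tsub_le_iff_right, ENNReal.ofReal_sum_of_nonneg fun e _ => hterm e,
    ENNReal.ofReal_sum_of_nonneg fun i _ => agentUtility_nonneg L i v,
    ← Finset.sum_filter_add_sum_filter_not _ (fun e => e ∈ favorites M v),
    thresholdAlloc_neg_one, add_right_comm]
  exact add_le_add hfav hrest

lemma extExpectation_le_lintegral {Ω : Type*} [MeasurableSpace Ω] (μ : Measure Ω) (f : Ω → ℝ) :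
    extExpectation μ f ≤ ((∫⁻ ω, ENNReal.ofReal (f ω) ∂μ : ℝ≥0∞) : EReal) := by
  rw [extExpectation]
  exact (EReal.sub_le_sub le_rfl (EReal.coe_ennreal_nonneg _)).trans (by simp)

end LotteryMechanism

theorem mainTheorem6 {I J : Type*} [Fintype I] [Fintype J] (P : BMUMD I J)
    (hP : P.IsMatroidUnitDemand) (L : P.LotteryMechanism) :
    L.expectedRevenue ≤ 5 * P.copies.myersonRevenue := by
  obtain ⟨⟨F, hF, hlaw⟩, M, hM⟩ := hP
  have : IsProbabilityMeasure P.law := hlaw ▸ inferInstance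
  set R := P.copies.myersonRevenue with hR
  have hthreshold := fun θ => lintegral_thresholdAlloc_le L hM θ
  -- Nonnegativity makes `R.toENNReal` lossless; the threshold 0 is an arbitrary choice.
  have hR0 : 0 ≤ R := (EReal.coe_ennreal_nonneg _).trans
    (lintegral_criticalPayment_le_myersonRevenue (P := P.copies)
      (thresholdAlloc_feasible L hM 0)
      (fun e => (measurable_const (a := (0 : ℝ))).prodMk measurable_id
        (measurableSet_mem_thresholdAlloc (M := M) L e))
      (thresholdAlloc_monotone L 0))
  have hmeas : Measurable fun p : ℝ × (I × J → ℝ≥0) =>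
      ∑ e, criticalPayment (thresholdAlloc L M p.1) e p.2 :=
    Finset.measurable_fun_sum _ fun e _ =>
      measurable_criticalPayment (x := thresholdAlloc L M) (e := e)
        (measurableSet_mem_thresholdAlloc L e)
  have hbound : ∫⁻ v, ENNReal.ofReal (∑ i, (L.choice i v).price) ∂P.law ≤ 5 * R.toENNReal := by
    calc _ ≤ ∫⁻ v, ((∫⁻ θ in Set.Ioo (0 : ℝ) 1,
              ∑ e, criticalPayment (thresholdAlloc L M θ) e v) +
            3 * ∑ e, criticalPayment (thresholdAlloc L M (-1)) e v) ∂P.law :=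
          lintegral_mono fun v => ofReal_sum_price_le L hM v
      _ = (∫⁻ θ in Set.Ioo (0 : ℝ) 1,
              ∫⁻ v, ∑ e, criticalPayment (thresholdAlloc L M θ) e v ∂P.law) +
            3 * ∫⁻ v, ∑ e, criticalPayment (thresholdAlloc L M (-1)) e v ∂P.law := by
          rw [lintegral_add_left hmeas.lintegral_prod_left',
            lintegral_const_mul' _ _ (by simp)]
          congr 1
          -- With `θ` outside, each inner integral is the revenue of one deterministic truthful
          -- mechanism.
          exact lintegral_lintegral_swap
            (f := fun v θ => ∑ e, criticalPayment (thresholdAlloc L M θ) e v)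
            (hmeas.comp measurable_swap).aemeasurable
      _ ≤ (∫⁻ _ in Set.Ioo (0 : ℝ) 1, R.toENNReal) + 3 * R.toENNReal :=
          add_le_add (lintegral_mono fun θ => hthreshold θ) (by gcongr; exact hthreshold _)
      _ = 4 * R.toENNReal := by
          rw [setLIntegral_const, Real.volume_Ioo, sub_zero, ENNReal.ofReal_one]
          ring
      -- The argument gives 4; the stated constant is weaker.
      _ ≤ 5 * R.toENNReal := by
          gcongr
          norm_num
  refine (extExpectation_le_lintegral _ _).trans ?_
  refine (EReal.coe_ennreal_le_coe_ennreal_iff.2 hbound).trans (le_of_eq ?_)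
  rw [EReal.coe_ennreal_mul, EReal.coe_toENNReal hR0]
  rfl
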